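/- Let $\beta\ge 2$ be an even integer, and let $$\Gamma_{\beta,\beta}=\int_{\mathbb R^\beta}\prod_{j=1}^{\beta}e^{-u_j^2}\prod_{1\le j<k\le\beta}|u_j-u_k|^{4/\beta}\,du_1\cdots du_\beta .$$ For real $x$ define the Kontsevich type integral $$K_{\beta,\beta}(x)=\lim_{c\to0^+}\left[-\frac{\beta!}{(2\pi \mathrm i)^\beta}\int dv_1\cdots\int dv_\beta\ \prod_{j=1}^{\beta}e^{v_j^3/3-xv_j}\prod_{1\le k<l\le\beta}(v_k-v_l)^{4/\beta}\right],$$ where the variables run upwards on the vertical line $\Re v=c$ in the order $\Im v_1>\Im v_2>\cdots>\Im v_\beta$ (so $v_1$ runs over the whole line from $c-\mathrm i\infty$ to $c+\mathrm i\infty$, and $v_j$ runs from $c-\mathrm i\infty$ to $v_{j-1}$), and the powers $(v_k-v_l)^{4/\beta}$ are principal. Then, for every real $x$, these integrals converge absolutely for every $c>0$ and the limit exists. Moreover, as $x\to+\infty$, $$K_{\beta,\beta}(x)=\frac{\Gamma_{\beta,\beta}}{(2\pi)^\beta}\,\frac{e^{-\frac{2\beta}{3}x^{3/2}}}{x^{3\beta/4-1/2}}+e^{-\frac{2\beta}{3}x^{3/2}}\,\mathrm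 O\!\left(\frac1{x^{3\beta/4+1}}\right).$$ In particular, $$K_{\beta,\beta}(x)=\frac{\Gamma_{\beta,\beta}}{(2\pi)^\beta}\,\frac{e^{-\frac{2\beta}{3}x^{3/2}}}{x^{3\beta/4-1/2}}+\mathrm O\!\left(\frac1{x^{3\beta/4+1}}\right).$$ -/

import Mathlib

open Filter Topology Asymptotics MeasureTheory

noncomputable section

/-- The Gaussian integral
`Γ_{n,β} = ∫_{ℝⁿ} ∏ⱼ exp(-uⱼ²) ∏_{j<k} |uⱼ - uₖ|^{4/β} du`. -/
def gammaInt (n : ℕ) (β : ℝ) : ℝ :=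
  ∫ u : Fin n → ℝ,
    (∏ j, Real.exp (-(u j) ^ 2)) * ∏ j, ∏ k ∈ Finset.Ioi j, |u j - u k| ^ (4 / β)

/-- The point with imaginary part `y` on the vertical line `Re v = c`. -/
def linePoint (c y : ℝ) : ℂ := (c : ℂ) + Complex.I * (y : ℂ)

/-- The integrand `∏ⱼ exp(vⱼ³/3 - x vⱼ) ∏_{k<l} (vₖ - vₗ)^{4/β}` pulled back to the line
`Re v = c` by `vⱼ = c + i yⱼ`; the factor `iⁿ` comes from `dvⱼ = i dyⱼ`.
The powers are principal: `arg (vₖ - vₗ) = 0` when `vₖ - vₗ > 0`. For `y₁ > ⋯ > yₙ` the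
differences have positive imaginary part, so the branch cut is never met. -/
def kontsevichIntegrand (n : ℕ) (β c x : ℝ) (y : Fin n → ℝ) : ℂ :=
  Complex.I ^ n *
    (∏ j, Complex.exp (linePoint c (y j) ^ 3 / 3 - (x : ℂ) * linePoint c (y j))) *
    ∏ k, ∏ l ∈ Finset.Ioi k, (linePoint c (y k) - linePoint c (y l)) ^ (((4 / β : ℝ)) : ℂ)

/-- The ordered domain: `v₁` runs up the whole vertical line, and `vⱼ` runs up the
same line from below and stops at `vⱼ₋₁`, so that `y₁ > y₂ > ⋯ > yₙ`. -/
def orderedDomain (n : ℕ) : Set (Fin n → ℝ) := {y | StrictAnti y}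

/-- The ordered multiple integral
`-(n!/(2πi)ⁿ) ∫ dv₁ ⋯ ∫ dvₙ ∏ⱼ exp(vⱼ³/3 - x vⱼ) ∏_{k<l} (vₖ - vₗ)^{4/β}`
along the vertical line `Re v = c`. It converges absolutely when `c > 0`. -/
def kontsevichLine (n : ℕ) (β c x : ℝ) : ℂ :=
  -((n.factorial : ℂ) / (2 * (Real.pi : ℂ) * Complex.I) ^ n) *
    ∫ y in orderedDomain n, kontsevichIntegrand n β c x y

/-- The Kontsevich type integral `K_{n,β}(x)` from `-i∞` to `i∞`. On the imaginary axis itself the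
integrand does not decay; as for the Airy function, the integral there is the limit of the
absolutely convergent integrals along `Re v = c` as `c → 0⁺`. -/
def kontsevichK (n : ℕ) (β x : ℝ) : ℂ :=
  limUnder (𝓝[>] (0 : ℝ)) (fun c : ℝ => kontsevichLine n β c x)

/-- The leading term `Γ_{β,β}/(2π)^β · exp(-(2β/3) x^{3/2}) x^{-3β/4+1/2}`. -/
def kontsevichLeading (β : ℕ) (x : ℝ) : ℝ :=
  gammaInt β β / (2 * Real.pi) ^ β *
    Real.exp (-(2 * (β : ℝ) / 3) * x ^ (3 / 2 : ℝ)) * x ^ (-(3 * (β : ℝ) / 4) + 1 / 2)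

end

/-!
The saddle point method for the Kontsevich type integral.

For even `n` the principal powers `(v_k - v_l)^{4/n} = (i (y_k - y_l))^{4/n}` on the ordered domain
are `|y_k - y_l|^{4/n}` up to phases whose product over all pairs is `-1`
(`I_cpow_pow_eq_neg_one`). What is left is symmetric in the variables and vanishes when two of them
coincide, so `n!` times the ordered integral is the integral over `ℝⁿ`. Hence the integral along
`Re v = c` equals `symmIntegral n (4 / n) x c / (2π)ⁿ` (`kontsevichLine_eq`).

The contour may be moved without Cauchy's theorem in several variables. The function `symmIntegral`
is complex differentiable in the base point `z` of the contour at every `z = c > 0`, and it does not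
change when `z` is replaced by `z + is`, since this amounts to translating all variables and the
weight depends only on differences. Therefore its complex derivative vanishes on the positive axis
and it is constant there (`symmIntegral_eq`). In particular the limit `c → 0⁺` exists.

Taking `c = √x`, the saddle point, and `y = x^{-1/4} u`, the exponent becomes
`-(2n/3) x^{3/2} - ∑ uⱼ² - i ε ∑ uⱼ³/3` with `ε = x^{-3/4}` (`symmIntegral_saddle`). At `ε = 0` the
integral is `gammaInt`; the term linear in `ε` is odd under `u ↦ -u` and integrates to zero, so the
error is `O(ε²) = O(x^{-3/2})` relative to the leading term
(`norm_integral_exp_mul_gaussianWeight_sub_le`).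
-/

/-! ### The weight `∏ |yⱼ - yₖ|^α` -/

/-- The weight `∏_{j<k} |yⱼ - yₖ|^α` on `ℝⁿ`. -/
noncomputable def vandermondeWeight (n : ℕ) (α : ℝ) (y : Fin n → ℝ) : ℝ :=
  ∏ j, ∏ k ∈ Finset.Ioi j, |y j - y k| ^ α

theorem vandermondeWeight_nonneg (n : ℕ) (α : ℝ) (y : Fin n → ℝ) :
    0 ≤ vandermondeWeight n α y :=
  Finset.prod_nonneg fun _ _ => Finset.prod_nonneg fun _ _ => by positivity

theorem continuous_vandermondeWeight (n : ℕ) {α : ℝ} (hα : 0 ≤ α) :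
    Continuous (vandermondeWeight n α) := by
  unfold vandermondeWeight
  refine continuous_finsetProd _ fun j _ => continuous_finsetProd _ fun k _ => ?_
  exact Continuous.rpow_const (by fun_prop) fun _ => Or.inr hα

theorem vandermondeWeight_eq_abs_det (n : ℕ) (α : ℝ) (y : Fin n → ℝ) :
    vandermondeWeight n α y = |(Matrix.vandermonde y).det| ^ α := by
  rw [Matrix.det_vandermonde, Finset.abs_prod, vandermondeWeight,
    ← Real.finsetProd_rpow _ _ fun _ _ => abs_nonneg _]
  refine Finset.prod_congr rfl fun j _ => ?_
  rw [Finset.abs_prod, ← Real.finsetProd_rpow _ _ fun _ _ => abs_nonneg _]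
  exact Finset.prod_congr rfl fun k _ => by rw [abs_sub_comm]

theorem vandermondeWeight_comp_perm (n : ℕ) (α : ℝ) (y : Fin n → ℝ)
    (σ : Equiv.Perm (Fin n)) : vandermondeWeight n α (y ∘ σ) = vandermondeWeight n α y := by
  have h : Matrix.vandermonde (y ∘ σ) = (Matrix.vandermonde y).submatrix σ id := rfl
  rw [vandermondeWeight_eq_abs_det, vandermondeWeight_eq_abs_det, h, Matrix.det_permute, abs_mul]
  rcases Int.units_eq_one_or (Equiv.Perm.sign σ) with h | h <;> simp [h]

theorem vandermondeWeight_eq_zero (n : ℕ) {α : ℝ} (hα : 0 < α) {y : Fin n → ℝ}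
    (hy : ¬ Function.Injective y) : vandermondeWeight n α y = 0 := by
  have h : (Matrix.vandermonde y).det = 0 := by
    by_contra h
    exact hy (Matrix.det_vandermonde_ne_zero_iff.1 h)
  rw [vandermondeWeight_eq_abs_det, h, abs_zero, Real.zero_rpow hα.ne']

theorem vandermondeWeight_add_const (n : ℕ) (α : ℝ) (y : Fin n → ℝ) (s : ℝ) :
    vandermondeWeight n α (y + fun _ => s) = vandermondeWeight n α y := by
  simp [vandermondeWeight]

theorem vandermondeWeight_neg (n : ℕ) (α : ℝ) (y : Fin n → ℝ) :
    vandermondeWeight n α (-y) = vandermondeWeight n α y := by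
  refine Finset.prod_congr rfl fun j _ => Finset.prod_congr rfl fun k _ => ?_
  rw [Pi.neg_apply, Pi.neg_apply, neg_sub_neg, abs_sub_comm]

theorem prod_prod_Ioi_const {M : Type*} [CommMonoid M] (n : ℕ) (a : M) :
    ∏ j : Fin n, ∏ _k ∈ Finset.Ioi j, a = a ^ (n * (n - 1) / 2) := by
  simp only [Finset.prod_const, Fin.card_Ioi]
  rw [Finset.prod_pow_eq_pow_sum, Fin.sum_univ_eq_sum_range (fun i => n - 1 - i),
    Finset.sum_range_reflect (fun i => i) n, Finset.sum_range_id]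

theorem vandermondeWeight_smul (n : ℕ) (α : ℝ) (y : Fin n → ℝ) {r : ℝ} (hr : 0 ≤ r) :
    vandermondeWeight n α (r • y) = (r ^ α) ^ (n * (n - 1) / 2) * vandermondeWeight n α y := by
  rw [← prod_prod_Ioi_const, vandermondeWeight, vandermondeWeight, ← Finset.prod_mul_distrib]
  refine Finset.prod_congr rfl fun j _ => ?_
  rw [← Finset.prod_mul_distrib]
  refine Finset.prod_congr rfl fun k _ => ?_
  rw [← Real.mul_rpow hr (abs_nonneg _), Pi.smul_apply, Pi.smul_apply, smul_eq_mul, smul_eq_mul,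
    ← mul_sub, abs_mul, abs_of_nonneg hr]

/-! ### Polynomial growth against Gaussian decay -/

/-- `∏ (1 + |yⱼ|)`, which bounds every coordinate; its powers measure polynomial growth. -/
noncomputable def coordGrowth (n : ℕ) (y : Fin n → ℝ) : ℝ := ∏ i, (1 + |y i|)

theorem one_le_coordGrowth (n : ℕ) (y : Fin n → ℝ) : 1 ≤ coordGrowth n y :=
  Finset.one_le_prod fun i _ => by linarith [abs_nonneg (y i)]

theorem one_add_abs_le_coordGrowth {n : ℕ} (y : Fin n → ℝ) (j : Fin n) :
    1 + |y j| ≤ coordGrowth n y := by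
  rw [coordGrowth, ← Finset.mul_prod_erase _ _ (Finset.mem_univ j)]
  exact le_mul_of_one_le_right (by positivity)
    (Finset.one_le_prod fun i _ => by linarith [abs_nonneg (y i)])

theorem vandermondeWeight_le (n : ℕ) {α : ℝ} (hα : 0 ≤ α) :
    ∃ N : ℕ, ∀ y : Fin n → ℝ, vandermondeWeight n α y ≤ coordGrowth n y ^ N := by
  refine ⟨2 * ⌈α⌉₊ * (n * (n - 1) / 2), fun y => ?_⟩
  have h1 := one_le_coordGrowth n y
  rw [pow_mul, ← prod_prod_Ioi_const]
  refine Finset.prod_le_prod (fun j _ => Finset.prod_nonneg fun k _ => by positivity) fun j _ =>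
    Finset.prod_le_prod (fun k _ => by positivity) fun k _ => ?_
  have h2 : |y j - y k| ≤ coordGrowth n y ^ 2 := by
    have hj := one_add_abs_le_coordGrowth y j
    have hk := one_add_abs_le_coordGrowth y k
    have := abs_sub (y j) (y k)
    nlinarith [abs_nonneg (y j), abs_nonneg (y k)]
  calc |y j - y k| ^ α ≤ (coordGrowth n y ^ 2) ^ α :=
        Real.rpow_le_rpow (abs_nonneg _) h2 hα
    _ ≤ (coordGrowth n y ^ 2) ^ (⌈α⌉₊ : ℝ) :=
        Real.rpow_le_rpow_of_exponent_le (one_le_pow₀ h1) (Nat.le_ceil α)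
    _ = coordGrowth n y ^ (2 * ⌈α⌉₊) := by rw [Real.rpow_natCast, ← pow_mul]

theorem one_add_abs_pow_le_exp (N : ℕ) {a : ℝ} (ha : 0 < a) :
    ∃ C : ℝ, ∀ t : ℝ, (1 + |t|) ^ N ≤ C * Real.exp (a * t ^ 2) := by
  refine ⟨N.factorial * Real.exp (1 + 1 / a), fun t => ?_⟩
  have h := Real.pow_div_factorial_le_exp (x := 1 + |t|) (by positivity) N
  rw [div_le_iff₀ (by positivity)] at h
  have h2 : 1 + |t| ≤ 1 + 1 / a + a * t ^ 2 := by
    have : |t| * a ≤ 1 + (a * |t|) ^ 2 := by nlinarith [sq_nonneg (a * |t| - 1)]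
    have h3 : |t| ≤ (1 + (a * |t|) ^ 2) / a := by rwa [le_div_iff₀ ha]
    have h4 : (1 + (a * |t|) ^ 2) / a = 1 / a + a * t ^ 2 := by
      rw [mul_pow, sq_abs]; field_simp
    linarith
  calc (1 + |t|) ^ N ≤ Real.exp (1 + |t|) * N.factorial := h
    _ ≤ Real.exp (1 + 1 / a + a * t ^ 2) * N.factorial := by gcongr
    _ = _ := by rw [Real.exp_add]; ring

theorem integrable_coordGrowth_pow_mul_gaussian (n N : ℕ) {a : ℝ} (ha : 0 < a) :
    Integrable fun y : Fin n → ℝ => coordGrowth n y ^ N * ∏ j, Real.exp (-a * y j ^ 2) := by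
  obtain ⟨C, hC⟩ := one_add_abs_pow_le_exp N (half_pos ha)
  have h1 : Integrable fun t : ℝ => (1 + |t|) ^ N * Real.exp (-a * t ^ 2) := by
    refine ((integrable_exp_neg_mul_sq (half_pos ha)).const_mul C).mono'
      (Continuous.aestronglyMeasurable (by fun_prop)) (ae_of_all _ fun t => ?_)
    rw [Real.norm_of_nonneg (by positivity)]
    calc (1 + |t|) ^ N * Real.exp (-a * t ^ 2)
        ≤ C * Real.exp (a / 2 * t ^ 2) * Real.exp (-a * t ^ 2) := by gcongr; exact hC t
      _ = C * Real.exp (-(a / 2) * t ^ 2) := by rw [mul_assoc, ← Real.exp_add]; ring_nf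
  have h2 := Integrable.fintype_prod (ι := Fin n) (μ := fun _ => (volume : Measure ℝ))
    (f := fun _ => fun t : ℝ => (1 + |t|) ^ N * Real.exp (-a * t ^ 2)) fun _ => h1
  refine h2.congr (ae_of_all _ fun y => ?_)
  simp only [coordGrowth, Finset.prod_mul_distrib, Finset.prod_pow]

theorem integrable_of_le_coordGrowth_mul_gaussian {n N : ℕ} {E : Type*} [NormedAddCommGroup E]
    {f : (Fin n → ℝ) → E} (hf : Continuous f) {a C : ℝ} (ha : 0 < a)
    (h : ∀ y, ‖f y‖ ≤ C * (coordGrowth n y ^ N * ∏ j, Real.exp (-a * y j ^ 2))) :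
    Integrable f :=
  ((integrable_coordGrowth_pow_mul_gaussian n N ha).const_mul C).mono'
    hf.aestronglyMeasurable (ae_of_all _ h)

/-! ### Symmetrisation over the ordered domain -/

theorem measurableSet_orderedDomain (n : ℕ) : MeasurableSet (orderedDomain n) := by
  have : orderedDomain n = ⋂ (i : Fin n) (j : Fin n) (_ : i < j), {y | y j < y i} := by
    ext y
    simp only [orderedDomain, Set.mem_ofPred_eq, Set.mem_iInter]
    exact ⟨fun h i j hij => h hij, fun h i j hij => h i j hij⟩
  rw [this]
  exact MeasurableSet.iInter fun i => MeasurableSet.iInter fun j => MeasurableSet.iInter fun _ =>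
    measurableSet_lt (measurable_pi_apply j) (measurable_pi_apply i)

theorem existsUnique_perm_comp_mem_orderedDomain {n : ℕ} {y : Fin n → ℝ}
    (hy : Function.Injective y) : ∃! σ : Equiv.Perm (Fin n), y ∘ σ ∈ orderedDomain n := by
  have hneg : Function.Injective fun i => -y i := fun i j h => hy (neg_injective h)
  refine ⟨Tuple.sort fun i => -y i, ?_, fun τ hτ => ?_⟩
  · have h := (Tuple.monotone_sort fun i => -y i).strictMono_of_injective
      (hneg.comp (Equiv.injective _))
    exact fun i j hij => neg_lt_neg_iff.1 (h hij)
  · have h : Monotone ((fun i => -y i) ∘ τ) := fun i j hij =>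
      neg_le_neg (StrictAnti.antitone hτ hij)
    exact Equiv.ext fun i => hneg
      (congrFun (Tuple.unique_monotone h (Tuple.monotone_sort fun i => -y i)) i)

theorem measurePreserving_comp_perm {n : ℕ} (σ : Equiv.Perm (Fin n)) :
    MeasurePreserving (fun y : Fin n → ℝ => y ∘ σ) :=
  volume_preserving_arrowCongr' σ.symm (MeasurableEquiv.refl ℝ) (MeasurePreserving.id _)

/-- Up to the null set of tuples with a repeated entry, on which `f` is assumed to vanish,
`ℝⁿ` is the disjoint union of the `n!` images of the ordered domain under permutations. -/
theorem integral_eq_factorial_mul_setIntegral_orderedDomain {n : ℕ} {f : (Fin n → ℝ) → ℂ}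
    (hf : Integrable f) (hsymm : ∀ (σ : Equiv.Perm (Fin n)) y, f (y ∘ σ) = f y)
    (hzero : ∀ y, ¬ Function.Injective y → f y = 0) :
    ∫ y, f y = n.factorial * ∫ y in orderedDomain n, f y := by
  classical
  set g := (orderedDomain n).indicator f with hg
  have hgint : Integrable g := hf.indicator (measurableSet_orderedDomain n)
  have hsum : ∀ y, f y = ∑ σ : Equiv.Perm (Fin n), g (y ∘ σ) := by
    intro y
    by_cases hy : Function.Injective y
    · obtain ⟨σ, hσ, huniq⟩ := existsUnique_perm_comp_mem_orderedDomain hy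
      rw [Finset.sum_eq_single σ, hg, Set.indicator_of_mem hσ, hsymm]
      · intro τ _ hτ
        exact Set.indicator_of_notMem (fun h => hτ (huniq τ h)) _
      · simp
    · have : ∀ σ : Equiv.Perm (Fin n), g (y ∘ σ) = 0 := fun σ => by
        rw [hg, Set.indicator_apply, hsymm, hzero y hy, ite_self]
      simp [this, hzero y hy]
  have hint : ∀ σ : Equiv.Perm (Fin n), ∫ y, g (y ∘ σ) = ∫ y, g y := fun σ =>
    (measurePreserving_comp_perm σ).integral_comp'
      (f := MeasurableEquiv.arrowCongr' σ.symm (MeasurableEquiv.refl ℝ)) g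
  have hint' : ∀ σ : Equiv.Perm (Fin n), Integrable fun y => g (y ∘ σ) := fun σ =>
    (measurePreserving_comp_perm σ).integrable_comp_of_integrable hgint
  calc ∫ y, f y = ∫ y, ∑ σ : Equiv.Perm (Fin n), g (y ∘ σ) := integral_congr_ae (ae_of_all _ hsum)
    _ = ∑ σ : Equiv.Perm (Fin n), ∫ y, g (y ∘ σ) := integral_finsetSum _ fun σ _ => hint' σ
    _ = n.factorial * ∫ y, g y := by
      simp only [hint, Finset.sum_const, Finset.card_univ, Fintype.card_perm, Fintype.card_fin,
        nsmul_eq_mul]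
    _ = _ := by rw [hg, integral_indicator (measurableSet_orderedDomain n)]

/-! ### The symmetrised integral and its independence of the contour -/

/-- The exponent `∑ⱼ ((z + i yⱼ)³/3 - x (z + i yⱼ))`. -/
noncomputable def cubicPhase (n : ℕ) (x : ℝ) (z : ℂ) (y : Fin n → ℝ) : ℂ :=
  ∑ j, ((z + Complex.I * y j) ^ 3 / 3 - x * (z + Complex.I * y j))

/-- The Kontsevich integrand on the shifted contour `z + iℝ`, without its constant phase and with
the absolute value of the differences, so that it is symmetric on all of `ℝⁿ`. -/
noncomputable def symmIntegrand (n : ℕ) (α x : ℝ) (z : ℂ) (y : Fin n → ℝ) : ℂ :=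
  Complex.exp (cubicPhase n x z y) * vandermondeWeight n α y

/-- The integral of `symmIntegrand` over `ℝⁿ`, as a function of the base point `z` of the
contour. -/
noncomputable def symmIntegral (n : ℕ) (α x : ℝ) (z : ℂ) : ℂ := ∫ y, symmIntegrand n α x z y

theorem continuous_symmIntegrand (n : ℕ) {α : ℝ} (hα : 0 ≤ α) (x : ℝ) (z : ℂ) :
    Continuous (symmIntegrand n α x z) := by
  have := continuous_vandermondeWeight n hα
  unfold symmIntegrand cubicPhase
  fun_prop

theorem cubicPhase_re (n : ℕ) (x : ℝ) (z : ℂ) (y : Fin n → ℝ) :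
    (cubicPhase n x z y).re = ∑ j, (z.re ^ 3 / 3 - z.re * (z.im + y j) ^ 2 - x * z.re) := by
  rw [cubicPhase, Complex.re_sum]
  refine Finset.sum_congr rfl fun j _ => ?_
  have h : z + Complex.I * y j = ⟨z.re, z.im + y j⟩ := by
    apply Complex.ext <;> simp
  have h3 : ((⟨z.re, z.im + y j⟩ : ℂ) ^ 3 / 3).re
      = z.re ^ 3 / 3 - z.re * (z.im + y j) ^ 2 := by
    rw [show (3 : ℂ) = ((3 : ℝ) : ℂ) by norm_num, Complex.div_ofReal_re]
    simp only [pow_succ, pow_zero, one_mul, Complex.mul_re, Complex.mul_im]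
    ring
  rw [h, Complex.sub_re, h3, Complex.re_ofReal_mul]

/-- Near a point `c > 0` the integrand has a Gaussian bound which is uniform in `z`. -/
theorem norm_exp_cubicPhase_le (n : ℕ) (x : ℝ) {c : ℝ} (hc : 0 < c) :
    ∃ C : ℝ, 0 ≤ C ∧ ∀ z : ℂ, dist z c < c / 2 → ∀ y : Fin n → ℝ,
      ‖Complex.exp (cubicPhase n x z y)‖ ≤ C * ∏ j, Real.exp (-(c / 4) * y j ^ 2) := by
  set B := (2 * c) ^ 3 / 3 + 2 * c * c ^ 2 + |x| * (2 * c) with hB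
  refine ⟨Real.exp B ^ n, by positivity, fun z hz y => ?_⟩
  rw [Complex.dist_eq] at hz
  have hre := (Complex.abs_re_le_norm (z - c)).trans_lt hz
  have him := (Complex.abs_im_le_norm (z - c)).trans_lt hz
  simp only [Complex.sub_re, Complex.ofReal_re, Complex.sub_im, Complex.ofReal_im, sub_zero] at *
  rw [abs_lt] at hre him
  rw [Complex.norm_exp, cubicPhase_re, Real.exp_sum]
  calc ∏ j, Real.exp (z.re ^ 3 / 3 - z.re * (z.im + y j) ^ 2 - x * z.re)
      ≤ ∏ j : Fin n, (Real.exp B * Real.exp (-(c / 4) * y j ^ 2)) := by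
        refine Finset.prod_le_prod (fun _ _ => (Real.exp_pos _).le) fun j _ => ?_
        rw [← Real.exp_add]
        refine Real.exp_le_exp.2 ?_
        have h1 : z.re ^ 3 ≤ (2 * c) ^ 3 :=
          pow_le_pow_left₀ (by linarith) (by linarith) 3
        have h2 : -(x * z.re) ≤ |x| * (2 * c) := by
          calc -(x * z.re) ≤ |x * z.re| := neg_le_abs _
            _ = |x| * z.re := by rw [abs_mul, abs_of_pos (show 0 < z.re by linarith)]
            _ ≤ _ := by gcongr; linarith
        -- `(s + y)² ≥ y²/2 - s²`
        have h3 : y j ^ 2 / 2 - c ^ 2 ≤ (z.im + y j) ^ 2 := by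
          have : z.im ^ 2 ≤ c ^ 2 := by nlinarith
          nlinarith [sq_nonneg (2 * z.im + y j)]
        have h4 : c / 2 * (y j ^ 2 / 2) - 2 * c * c ^ 2 ≤ z.re * (z.im + y j) ^ 2 := by
          have h5 : z.re * (y j ^ 2 / 2 - c ^ 2) ≤ z.re * (z.im + y j) ^ 2 :=
            mul_le_mul_of_nonneg_left h3 (by linarith)
          have h6 : c / 2 * (y j ^ 2 / 2) ≤ z.re * (y j ^ 2 / 2) :=
            mul_le_mul_of_nonneg_right (by linarith) (by positivity)
          have h7 : z.re * c ^ 2 ≤ 2 * c * c ^ 2 :=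
            mul_le_mul_of_nonneg_right (by linarith) (by positivity)
          linarith
        rw [hB]; linarith
    _ = _ := by rw [Finset.prod_mul_distrib]; simp

theorem integrable_symmIntegrand (n : ℕ) {α : ℝ} (hα : 0 ≤ α) (x : ℝ) {c : ℝ} (hc : 0 < c) :
    Integrable (symmIntegrand n α x c) := by
  obtain ⟨C, hC0, hC⟩ := norm_exp_cubicPhase_le n x hc
  obtain ⟨N, hN⟩ := vandermondeWeight_le n hα
  refine integrable_of_le_coordGrowth_mul_gaussian (N := N) (C := C)
    (continuous_symmIntegrand n hα x c) (by positivity : 0 < c / 4) fun y => ?_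
  rw [symmIntegrand, norm_mul, Complex.norm_real,
    Real.norm_of_nonneg (vandermondeWeight_nonneg n α y)]
  calc _ ≤ (C * ∏ j, Real.exp (-(c / 4) * y j ^ 2)) * coordGrowth n y ^ N :=
        mul_le_mul (hC c (by simpa using hc) y) (hN y) (vandermondeWeight_nonneg n α y)
          (by positivity)
    _ = _ := by ring

theorem hasDerivAt_cubicPhase (n : ℕ) (x : ℝ) (y : Fin n → ℝ) (z : ℂ) :
    HasDerivAt (fun z => cubicPhase n x z y) (∑ j, ((z + Complex.I * y j) ^ 2 - x)) z := by
  refine HasDerivAt.fun_sum fun j _ => ?_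
  have h := (hasDerivAt_id z).add_const (Complex.I * y j)
  refine (((h.pow 3).div_const 3).sub (h.const_mul (x : ℂ))).congr_deriv ?_
  simp

theorem norm_sum_sq_sub_le (n : ℕ) (x : ℝ) (z : ℂ) (y : Fin n → ℝ) {R : ℝ} (hz : ‖z‖ ≤ R) :
    ‖∑ j, ((z + Complex.I * y j) ^ 2 - x)‖ ≤ n * ((1 + R) ^ 2 + |x|) * coordGrowth n y ^ 2 := by
  have h1 := one_le_coordGrowth n y
  have hR : 0 ≤ R := (norm_nonneg z).trans hz
  calc _ ≤ ∑ j : Fin n, ((1 + R) ^ 2 + |x|) * coordGrowth n y ^ 2 := by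
        refine norm_sum_le_of_le _ fun j _ => ?_
        have hj := one_add_abs_le_coordGrowth y j
        have h2 : ‖z + Complex.I * y j‖ ≤ (1 + R) * coordGrowth n y := by
          refine (norm_add_le _ _).trans ?_
          rw [norm_mul, Complex.norm_I, one_mul, Complex.norm_real, Real.norm_eq_abs]
          nlinarith
        refine (norm_sub_le _ _).trans ?_
        rw [norm_pow, Complex.norm_real, Real.norm_eq_abs, add_mul, ← mul_pow]
        gcongr
        exact le_mul_of_one_le_right (abs_nonneg _) (one_le_pow₀ h1)
    _ = _ := by simp; ring

theorem differentiableAt_symmIntegral (n : ℕ) {α : ℝ} (hα : 0 ≤ α) (x : ℝ) {c : ℝ} (hc : 0 < c) :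
    DifferentiableAt ℂ (symmIntegral n α x) c := by
  obtain ⟨C, hC0, hC⟩ := norm_exp_cubicPhase_le n x hc
  obtain ⟨N, hN⟩ := vandermondeWeight_le n hα
  have hw := continuous_vandermondeWeight n hα
  set M := n * ((1 + 2 * c) ^ 2 + |x|)
  have key := hasDerivAt_integral_of_dominated_loc_of_deriv_le (𝕜 := ℂ)
    (μ := (volume : Measure (Fin n → ℝ))) (F := symmIntegrand n α x) (x₀ := (c : ℂ))
    (F' := fun z y => Complex.exp (cubicPhase n x z y) * (∑ j, ((z + Complex.I * y j) ^ 2 - x)) *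
      vandermondeWeight n α y)
    (bound := fun y => C * M * (coordGrowth n y ^ (2 + N) * ∏ j, Real.exp (-(c / 4) * y j ^ 2)))
    (Metric.ball_mem_nhds (c : ℂ) (half_pos hc))
    (Eventually.of_forall fun z => (continuous_symmIntegrand n hα x z).aestronglyMeasurable)
    (integrable_symmIntegrand n hα x hc)
    (Continuous.aestronglyMeasurable (by unfold cubicPhase; fun_prop)) ?_
    ((integrable_coordGrowth_pow_mul_gaussian n (2 + N) (by positivity)).const_mul _) ?_
  · exact key.2.differentiableAt
  · refine ae_of_all _ fun y z hz => ?_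
    have hz' : ‖z‖ ≤ 2 * c := by
      have h1 : ‖z - c‖ < c / 2 := by rwa [Metric.mem_ball, Complex.dist_eq] at hz
      have h2 : ‖(c : ℂ)‖ = c := by rw [Complex.norm_real, Real.norm_of_nonneg hc.le]
      have h3 := norm_sub_norm_le z (c : ℂ)
      linarith
    have h1 := one_le_coordGrowth n y
    rw [norm_mul, norm_mul, Complex.norm_real,
      Real.norm_of_nonneg (vandermondeWeight_nonneg n α y)]
    calc _ ≤ (C * ∏ j, Real.exp (-(c / 4) * y j ^ 2)) * (M * coordGrowth n y ^ 2) *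
          coordGrowth n y ^ N := by
          gcongr
          · exact vandermondeWeight_nonneg n α y
          · exact hC z hz y
          · exact norm_sum_sq_sub_le n x z y hz'
          · exact hN y
      _ = _ := by rw [pow_add]; ring
  · exact ae_of_all _ fun y z _ => ((hasDerivAt_cubicPhase n x y z).cexp).mul_const _

/-- Translating all variables by `s` moves the base point by `is`, and the weight only sees
differences. -/
theorem symmIntegral_add_I_mul (n : ℕ) (α x : ℝ) (z : ℂ) (s : ℝ) :
    symmIntegral n α x (z + Complex.I * s) = symmIntegral n α x z := by
  rw [symmIntegral, symmIntegral,
    ← integral_add_right_eq_self (symmIntegrand n α x z) (fun _ => s)]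
  refine integral_congr_ae (ae_of_all _ fun y => ?_)
  simp only [symmIntegrand, vandermondeWeight_add_const]
  congr 2
  refine Finset.sum_congr rfl fun j _ => ?_
  simp only [Pi.add_apply, Complex.ofReal_add]
  ring

/-- The complex derivative can be computed in the imaginary direction, along which the integral
does not change. -/
theorem deriv_symmIntegral_eq_zero (n : ℕ) {α : ℝ} (hα : 0 ≤ α) (x : ℝ) {c : ℝ} (hc : 0 < c) :
    deriv (symmIntegral n α x) c = 0 := by
  have h1 := (differentiableAt_symmIntegral n hα x hc).hasDerivAt
  have h2 : HasDerivAt (fun s : ℝ => (c : ℂ) + Complex.I * s) Complex.I 0 := by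
    simpa using ((Complex.ofRealCLM.hasDerivAt (x := (0 : ℝ))).const_mul Complex.I).const_add
      (c : ℂ)
  have h3 := HasDerivAt.comp (𝕜 := ℝ) (0 : ℝ)
    (h₂ := symmIntegral n α x) (h₂' := deriv (symmIntegral n α x) c) (by simpa using h1) h2
  have h4 : (symmIntegral n α x ∘ fun s : ℝ => (c : ℂ) + Complex.I * s)
      = fun _ => symmIntegral n α x c :=
    funext fun s => symmIntegral_add_I_mul n α x c s
  rw [h4] at h3
  have h5 := h3.unique (hasDerivAt_const _ _)
  exact (mul_eq_zero.1 h5).resolve_right Complex.I_ne_zero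

theorem symmIntegral_eq (n : ℕ) {α : ℝ} (hα : 0 ≤ α) (x : ℝ) {c d : ℝ} (hc : 0 < c)
    (hd : 0 < d) : symmIntegral n α x c = symmIntegral n α x d := by
  have h : ∀ a ∈ Set.Ioi (0 : ℝ), HasDerivAt (fun a : ℝ => symmIntegral n α x a) 0 a := by
    intro a ha
    have := (differentiableAt_symmIntegral n hα x ha).hasDerivAt.comp_ofReal
    rwa [deriv_symmIntegral_eq_zero n hα x ha] at this
  exact isOpen_Ioi.is_const_of_deriv_eq_zero isPreconnected_Ioi
    (fun a ha => (h a ha).differentiableAt.differentiableWithinAt)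
    (fun a ha => (h a ha).deriv) hc hd

/-! ### Expansion at the saddle point -/

/-- The weight of `gammaInt`: the Gaussian times `∏ |uⱼ - uₖ|^α`. -/
noncomputable def gaussianWeight (n : ℕ) (α : ℝ) (u : Fin n → ℝ) : ℝ :=
  (∏ j, Real.exp (-(u j) ^ 2)) * vandermondeWeight n α u

/-- The cubic term `∑ⱼ uⱼ³/3` of the phase. -/
noncomputable def cubicSum (n : ℕ) (u : Fin n → ℝ) : ℝ := ∑ j, u j ^ 3 / 3

theorem gaussianWeight_nonneg (n : ℕ) (α : ℝ) (u : Fin n → ℝ) : 0 ≤ gaussianWeight n α u :=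
  mul_nonneg (Finset.prod_nonneg fun _ _ => (Real.exp_pos _).le) (vandermondeWeight_nonneg n α u)

theorem continuous_gaussianWeight (n : ℕ) {α : ℝ} (hα : 0 ≤ α) :
    Continuous (gaussianWeight n α) := by
  have := continuous_vandermondeWeight n hα
  unfold gaussianWeight
  fun_prop

theorem continuous_cubicSum (n : ℕ) : Continuous (cubicSum n) := by
  unfold cubicSum
  fun_prop

theorem abs_cubicSum_le (n : ℕ) (u : Fin n → ℝ) : |cubicSum n u| ≤ n * coordGrowth n u ^ 3 := by
  calc |cubicSum n u| ≤ ∑ _j : Fin n, coordGrowth n u ^ 3 := by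
        refine (Finset.abs_sum_le_sum_abs _ _).trans (Finset.sum_le_sum fun j _ => ?_)
        have h : |u j| ^ 3 ≤ coordGrowth n u ^ 3 :=
          pow_le_pow_left₀ (abs_nonneg _) (by linarith [one_add_abs_le_coordGrowth u j]) 3
        rw [abs_div, abs_pow, abs_of_pos (by norm_num : (0 : ℝ) < 3)]
        linarith [pow_nonneg (abs_nonneg (u j)) 3]
    _ = _ := by simp

theorem integrable_cubicSum_pow_mul_gaussianWeight (n : ℕ) {α : ℝ} (hα : 0 ≤ α) (k : ℕ) :
    Integrable fun u => cubicSum n u ^ k * gaussianWeight n α u := by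
  obtain ⟨N, hN⟩ := vandermondeWeight_le n hα
  refine integrable_of_le_coordGrowth_mul_gaussian (N := 3 * k + N) (C := n ^ k) (a := 1)
    (((continuous_cubicSum n).pow k).mul (continuous_gaussianWeight n hα)) one_pos fun u => ?_
  have h1 := one_le_coordGrowth n u
  have h2 : ∀ j, (-1 : ℝ) * u j ^ 2 = -(u j) ^ 2 := fun j => by ring
  rw [norm_mul, norm_pow, Real.norm_eq_abs, Real.norm_of_nonneg (gaussianWeight_nonneg n α u),
    gaussianWeight]
  simp only [h2]
  calc _ ≤ (n * coordGrowth n u ^ 3) ^ k *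
        ((∏ j, Real.exp (-(u j) ^ 2)) * coordGrowth n u ^ N) := by
        gcongr
        · exact gaussianWeight_nonneg n α u
        · exact abs_cubicSum_le n u
        · exact hN u
    _ = _ := by rw [mul_pow, pow_add, pow_mul]; ring

theorem integral_cubicSum_mul_gaussianWeight (n : ℕ) (α : ℝ) :
    ∫ u, cubicSum n u * gaussianWeight n α u = 0 := by
  have h := integral_neg_eq_self (fun u => cubicSum n u * gaussianWeight n α u) volume
  have hodd : ∀ u, cubicSum n (-u) * gaussianWeight n α (-u)
      = -(cubicSum n u * gaussianWeight n α u) := by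
    intro u
    have h1 : cubicSum n (-u) = -cubicSum n u := by
      rw [cubicSum, cubicSum, ← Finset.sum_neg_distrib]
      exact Finset.sum_congr rfl fun j _ => by rw [Pi.neg_apply]; ring
    rw [h1, gaussianWeight, gaussianWeight, vandermondeWeight_neg]
    simp
  simp only [hodd, integral_neg] at h
  linarith

theorem norm_exp_I_mul_sub_one_sub_le (t : ℝ) :
    ‖Complex.exp (Complex.I * t) - 1 - Complex.I * t‖ ≤ 2 * t ^ 2 := by
  have hn : ‖Complex.I * (t : ℂ)‖ = |t| := by simp
  rcases le_total |t| 1 with h | h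
  · have := Complex.norm_exp_sub_one_sub_id_le (x := Complex.I * t) (by rwa [hn])
    rw [hn, sq_abs] at this
    nlinarith [sq_nonneg t]
  · have h1 := norm_sub_le (Complex.exp (Complex.I * t) - 1) (Complex.I * t)
    have h2 := Real.norm_exp_I_mul_ofReal_sub_one_le (x := t)
    rw [Real.norm_eq_abs] at h2
    rw [hn] at h1
    nlinarith [sq_abs t]

/-- The term of order `ε` is odd in `u`, so that only a quadratic error remains. -/
theorem norm_integral_exp_mul_gaussianWeight_sub_le (n : ℕ) {α : ℝ} (hα : 0 ≤ α) :
    ∃ C : ℝ, ∀ ε : ℝ,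
      ‖(∫ u, Complex.exp (Complex.I * ↑(ε * cubicSum n u)) * (gaussianWeight n α u : ℂ)) -
        ((∫ u, gaussianWeight n α u : ℝ) : ℂ)‖ ≤ C * ε ^ 2 := by
  refine ⟨∫ u, 2 * (cubicSum n u ^ 2 * gaussianWeight n α u), fun ε => ?_⟩
  have i0 : Integrable fun u => (gaussianWeight n α u : ℂ) := by
    simpa using (integrable_cubicSum_pow_mul_gaussianWeight n hα 0).ofReal (𝕜 := ℂ)
  have i1 : Integrable fun u => ((cubicSum n u * gaussianWeight n α u : ℝ) : ℂ) := by
    simpa using (integrable_cubicSum_pow_mul_gaussianWeight n hα 1).ofReal (𝕜 := ℂ)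
  have i2 := (integrable_cubicSum_pow_mul_gaussianWeight n hα 2).const_mul 2
  have hc := continuous_cubicSum n
  have ie : Integrable fun u =>
      Complex.exp (Complex.I * ↑(ε * cubicSum n u)) * (gaussianWeight n α u : ℂ) :=
    i0.bdd_mul (c := 1) (Continuous.aestronglyMeasurable (by fun_prop))
      (ae_of_all _ fun u => by rw [mul_comm, Complex.norm_exp_ofReal_mul_I])
  have h1 : (∫ u, ((cubicSum n u * gaussianWeight n α u : ℝ) : ℂ)) = 0 := by
    rw [integral_complex_ofReal, integral_cubicSum_mul_gaussianWeight, Complex.ofReal_zero]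
  have h2 : (∫ u, Complex.exp (Complex.I * ↑(ε * cubicSum n u)) * (gaussianWeight n α u : ℂ)) -
        ((∫ u, gaussianWeight n α u : ℝ) : ℂ) =
      ∫ u, (Complex.exp (Complex.I * ↑(ε * cubicSum n u)) * (gaussianWeight n α u : ℂ) -
        gaussianWeight n α u -
        Complex.I * ε * ((cubicSum n u * gaussianWeight n α u : ℝ) : ℂ)) := by
    have i01 : Integrable fun u =>
        Complex.exp (Complex.I * ↑(ε * cubicSum n u)) * (gaussianWeight n α u : ℂ) -
          gaussianWeight n α u := ie.sub i0
    rw [integral_sub i01 (i1.const_mul _), integral_sub ie i0, integral_const_mul, h1,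
      mul_zero, sub_zero, integral_complex_ofReal]
  rw [h2, ← integral_mul_const]
  refine norm_integral_le_of_norm_le (i2.mul_const _) (ae_of_all _ fun u => ?_)
  have h3 : Complex.exp (Complex.I * ↑(ε * cubicSum n u)) * (gaussianWeight n α u : ℂ) -
        gaussianWeight n α u -
        Complex.I * ε * ((cubicSum n u * gaussianWeight n α u : ℝ) : ℂ) =
      (Complex.exp (Complex.I * ↑(ε * cubicSum n u)) - 1 - Complex.I * ↑(ε * cubicSum n u)) *
        (gaussianWeight n α u : ℂ) := by
    push_cast; ring
  rw [h3, norm_mul, Complex.norm_real, Real.norm_of_nonneg (gaussianWeight_nonneg n α u)]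
  calc _ ≤ 2 * (ε * cubicSum n u) ^ 2 * gaussianWeight n α u :=
        mul_le_mul_of_nonneg_right (norm_exp_I_mul_sub_one_sub_le _) (gaussianWeight_nonneg n α u)
    _ = _ := by ring

/-- On the contour through the saddle point `√x = q²`, in the variable `u = x^{1/4} y`, the
exponent is its value at the saddle plus a Gaussian and a small imaginary cubic term. -/
theorem cubicPhase_saddle (n : ℕ) {q : ℝ} (hq : 0 < q) (u : Fin n → ℝ) :
    cubicPhase n (q ^ 4) ((q ^ 2 : ℝ) : ℂ) (q⁻¹ • u) =
      ((-(2 * n / 3) * q ^ 6 : ℝ) : ℂ) + ((∑ j, -(u j) ^ 2 : ℝ) : ℂ) +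
        Complex.I * ((-(q⁻¹ ^ 3) * cubicSum n u : ℝ) : ℂ) := by
  have hq' : (q : ℂ) ≠ 0 := by exact_mod_cast hq.ne'
  have h : ∀ j, (((q ^ 2 : ℝ) : ℂ) + Complex.I * ((q⁻¹ • u) j : ℝ)) ^ 3 / 3 -
      ((q ^ 4 : ℝ) : ℂ) * (((q ^ 2 : ℝ) : ℂ) + Complex.I * ((q⁻¹ • u) j : ℝ)) =
      -(2 / 3) * (q : ℂ) ^ 6 + -(u j : ℂ) ^ 2 +
        Complex.I * (-((q : ℂ)⁻¹ ^ 3) * ((u j : ℂ) ^ 3 / 3)) := by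
    intro j
    have hI3 : Complex.I ^ 3 = -Complex.I := by rw [pow_succ, Complex.I_sq]; ring
    simp only [Pi.smul_apply, smul_eq_mul, Complex.ofReal_mul, Complex.ofReal_inv,
      Complex.ofReal_pow]
    field_simp
    ring_nf
    rw [hI3, Complex.I_sq]
    ring
  rw [cubicPhase, Finset.sum_congr rfl fun j _ => h j, Finset.sum_add_distrib,
    Finset.sum_add_distrib, cubicSum]
  simp only [← Finset.mul_sum, Finset.sum_const, Finset.card_univ, Fintype.card_fin, nsmul_eq_mul]
  push_cast
  ring

theorem symmIntegral_saddle (n : ℕ) (α : ℝ) {q : ℝ} (hq : 0 < q) :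
    symmIntegral n α (q ^ 4) ((q ^ 2 : ℝ) : ℂ) =
      (((q⁻¹ ^ n * (q⁻¹ ^ α) ^ (n * (n - 1) / 2) * Real.exp (-(2 * n / 3) * q ^ 6) : ℝ)) : ℂ) *
        ∫ u, Complex.exp (Complex.I * ((-(q⁻¹ ^ 3) * cubicSum n u : ℝ) : ℂ)) *
          (gaussianWeight n α u : ℂ) := by
  have h := Measure.integral_comp_smul (volume : Measure (Fin n → ℝ))
    (symmIntegrand n α (q ^ 4) ((q ^ 2 : ℝ) : ℂ)) q⁻¹
  have hf : ∀ u, symmIntegrand n α (q ^ 4) ((q ^ 2 : ℝ) : ℂ) (q⁻¹ • u) =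
      ((((q⁻¹ ^ α) ^ (n * (n - 1) / 2) * Real.exp (-(2 * n / 3) * q ^ 6) : ℝ)) : ℂ) *
        (Complex.exp (Complex.I * ((-(q⁻¹ ^ 3) * cubicSum n u : ℝ) : ℂ)) *
          (gaussianWeight n α u : ℂ)) := by
    intro u
    rw [symmIntegrand, cubicPhase_saddle n hq, vandermondeWeight_smul n α u (inv_pos.2 hq).le,
      Complex.exp_add, Complex.exp_add, gaussianWeight, ← Real.exp_sum, ← Complex.ofReal_exp,
      ← Complex.ofReal_exp]
    push_cast
    ring
  simp_rw [hf] at h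
  rw [integral_const_mul, Module.finrank_fin_fun, inv_pow q n, inv_inv, abs_of_pos (pow_pos hq n)] at h
  have hq' : (q : ℂ) ^ n ≠ 0 := pow_ne_zero _ (by exact_mod_cast hq.ne')
  rw [symmIntegral, ← mul_right_inj' hq']
  rw [Complex.real_smul, Complex.ofReal_pow] at h
  have hcancel : (q : ℂ) ^ n * (q : ℂ)⁻¹ ^ n = 1 := by
    rw [← mul_pow, mul_inv_cancel₀ (by exact_mod_cast hq.ne'), one_pow]
  rw [← h]
  simp only [Complex.ofReal_mul, Complex.ofReal_pow, Complex.ofReal_inv]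
  rw [← mul_assoc, ← mul_assoc, ← mul_assoc, hcancel, one_mul]

/-! ### The Kontsevich integral -/

/-- For even `n` the powers `(i t)^{4/n}`, one for each of the `n(n-1)/2` pairs, contribute the
total phase `e^{iπ(n-1)} = -1`. -/
theorem I_cpow_pow_eq_neg_one {n : ℕ} (hn : 0 < n) (hev : Even n) :
    (Complex.I ^ (((4 / n : ℝ)) : ℂ)) ^ (n * (n - 1) / 2) = -1 := by
  obtain ⟨m, rfl⟩ := hev
  obtain ⟨k, rfl⟩ : ∃ k, m = k + 1 := ⟨m - 1, by omega⟩
  have h1 : (k + 1 + (k + 1)) * (k + 1 + (k + 1) - 1) / 2 = (k + 1) * (2 * k + 1) := by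
    rw [show k + 1 + (k + 1) - 1 = 2 * k + 1 by omega,
      show (k + 1 + (k + 1)) * (2 * k + 1) = 2 * ((k + 1) * (2 * k + 1)) by ring]
    simp
  have h2 : (k : ℂ) + 1 ≠ 0 := by exact_mod_cast k.succ_ne_zero
  rw [h1, Complex.cpow_def_of_ne_zero Complex.I_ne_zero, Complex.log_I, ← Complex.exp_nat_mul]
  have h3 : (((k + 1) * (2 * k + 1) : ℕ) : ℂ) *
      (Real.pi / 2 * Complex.I * ((4 / ((k + 1 + (k + 1) : ℕ) : ℝ) : ℝ) : ℂ)) =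
      k * (2 * Real.pi * Complex.I) + Real.pi * Complex.I := by
    push_cast
    field_simp
    ring
  rw [h3, Complex.exp_add, Complex.exp_nat_mul_two_pi_mul_I, Complex.exp_pi_mul_I, one_mul]

theorem I_mul_ofReal_cpow {t : ℝ} (ht : 0 < t) (a : ℝ) :
    (Complex.I * t) ^ (a : ℂ) = Complex.I ^ (a : ℂ) * ((t ^ a : ℝ) : ℂ) := by
  have ht' : (t : ℂ) ≠ 0 := by exact_mod_cast ht.ne'
  rw [Complex.cpow_def_of_ne_zero (mul_ne_zero Complex.I_ne_zero ht'),
    Complex.log_mul_ofReal t ht _ Complex.I_ne_zero, Complex.cpow_def_of_ne_zero Complex.I_ne_zero,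
    Complex.ofReal_cpow ht.le, Complex.cpow_def_of_ne_zero ht', ← Complex.exp_add,
    Complex.ofReal_log ht.le]
  ring_nf

theorem kontsevichIntegrand_eq {n : ℕ} (hn : 0 < n) (hev : Even n) (c x : ℝ) {y : Fin n → ℝ}
    (hy : y ∈ orderedDomain n) :
    kontsevichIntegrand n n c x y = -Complex.I ^ n * symmIntegrand n (4 / n) x c y := by
  have h1 : ∏ k, ∏ l ∈ Finset.Ioi k,
      (linePoint c (y k) - linePoint c (y l)) ^ (((4 / n : ℝ)) : ℂ) =
      -(vandermondeWeight n (4 / n) y : ℂ) := by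
    rw [← neg_one_mul, ← I_cpow_pow_eq_neg_one hn hev, ← prod_prod_Ioi_const, vandermondeWeight]
    simp only [Complex.ofReal_prod]
    rw [← Finset.prod_mul_distrib]
    refine Finset.prod_congr rfl fun k _ => ?_
    rw [← Finset.prod_mul_distrib]
    refine Finset.prod_congr rfl fun l hl => ?_
    have hkl : 0 < y k - y l := sub_pos.2 (hy (Finset.mem_Ioi.1 hl))
    have h2 : linePoint c (y k) - linePoint c (y l) = Complex.I * ((y k - y l : ℝ) : ℂ) := by
      rw [linePoint, linePoint]; push_cast; ring
    have h3 := I_mul_ofReal_cpow hkl (4 / n)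
    rw [h2, abs_of_pos hkl]
    exact h3
  rw [kontsevichIntegrand, h1, symmIntegrand, cubicPhase, Complex.exp_sum]
  simp only [linePoint]
  ring

theorem integrableOn_kontsevichIntegrand {n : ℕ} (hn : 0 < n) (hev : Even n) (x : ℝ) {c : ℝ}
    (hc : 0 < c) : IntegrableOn (kontsevichIntegrand n n c x) (orderedDomain n) :=
  (((integrable_symmIntegrand n (by positivity : (0 : ℝ) ≤ 4 / n) x hc).const_mul
    (-Complex.I ^ n)).integrableOn).congr_fun
      (fun _ hy => (kontsevichIntegrand_eq hn hev c x hy).symm) (measurableSet_orderedDomain n)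

theorem symmIntegrand_comp_perm (n : ℕ) (α x : ℝ) (z : ℂ) (σ : Equiv.Perm (Fin n))
    (y : Fin n → ℝ) : symmIntegrand n α x z (y ∘ σ) = symmIntegrand n α x z y := by
  rw [symmIntegrand, symmIntegrand, vandermondeWeight_comp_perm]
  congr 2
  exact Equiv.sum_comp σ fun j => ((z + Complex.I * y j) ^ 3 / 3 - x * (z + Complex.I * y j))

/-- The factor `n!` turns the ordered integral into one over `ℝⁿ`, and the phase `-1` of the
powers cancels the sign in front. -/
theorem kontsevichLine_eq {n : ℕ} (hn : 0 < n) (hev : Even n) (x : ℝ) {c : ℝ} (hc : 0 < c) :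
    kontsevichLine n n c x = symmIntegral n (4 / n) x c / (2 * Real.pi) ^ n := by
  have hα : (0 : ℝ) < 4 / n := by positivity
  have h := integral_eq_factorial_mul_setIntegral_orderedDomain
    (integrable_symmIntegrand n hα.le x hc) (symmIntegrand_comp_perm n _ x c) fun y hy => by
      rw [symmIntegrand, vandermondeWeight_eq_zero n hα hy, Complex.ofReal_zero, mul_zero]
  rw [kontsevichLine, setIntegral_congr_fun (measurableSet_orderedDomain n)
    fun y hy => kontsevichIntegrand_eq hn hev c x hy, integral_const_mul, symmIntegral, h, mul_pow]
  have hI : Complex.I ^ n ≠ 0 := pow_ne_zero _ Complex.I_ne_zero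
  have hpi : (2 * (Real.pi : ℂ)) ^ n ≠ 0 :=
    pow_ne_zero _ (mul_ne_zero two_ne_zero (by exact_mod_cast Real.pi_ne_zero))
  field_simp

theorem tendsto_kontsevichLine {n : ℕ} (hn : 0 < n) (hev : Even n) (x : ℝ) {c : ℝ} (hc : 0 < c) :
    Tendsto (fun c : ℝ => kontsevichLine n n c x) (𝓝[>] 0)
      (𝓝 (symmIntegral n (4 / n) x c / (2 * Real.pi) ^ n)) := by
  refine tendsto_const_nhds.congr' ?_
  filter_upwards [self_mem_nhdsWithin] with d hd
  rw [kontsevichLine_eq hn hev x hd,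
    symmIntegral_eq n (by positivity : (0 : ℝ) ≤ 4 / n) x hc hd]

theorem kontsevichK_eq {n : ℕ} (hn : 0 < n) (hev : Even n) (x : ℝ) {c : ℝ} (hc : 0 < c) :
    kontsevichK n n x = symmIntegral n (4 / n) x c / (2 * Real.pi) ^ n :=
  (tendsto_kontsevichLine hn hev x hc).limUnder_eq

/-- The Jacobian `x^{-n/4}` times the scaling of the weight. -/
theorem saddle_scaling {n : ℕ} (hn : 0 < n) {x : ℝ} (hx : 0 < x) :
    (x ^ (1 / 4 : ℝ))⁻¹ ^ n * ((x ^ (1 / 4 : ℝ))⁻¹ ^ (4 / n : ℝ)) ^ (n * (n - 1) / 2) =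
      x ^ (-(3 * (n : ℝ) / 4) + 1 / 2) := by
  have hn' : (n : ℝ) ≠ 0 := by exact_mod_cast hn.ne'
  have h2 : ((n * (n - 1) / 2 : ℕ) : ℝ) = n * (n - 1) / 2 := by
    rw [Nat.cast_div (Nat.even_mul_pred_self n).two_dvd two_ne_zero, Nat.cast_mul,
      Nat.cast_pred hn, Nat.cast_ofNat]
  rw [← Real.rpow_neg hx.le, ← Real.rpow_natCast, ← Real.rpow_natCast, ← Real.rpow_mul hx.le,
    ← Real.rpow_mul hx.le, ← Real.rpow_mul hx.le, ← Real.rpow_add hx, h2]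
  congr 1
  field_simp
  ring

theorem kontsevichK_sub_leading_isBigO {n : ℕ} (hn : 0 < n) (hev : Even n) :
    (fun x : ℝ => kontsevichK n n x - ((kontsevichLeading n x : ℝ) : ℂ)) =O[atTop]
      fun x : ℝ => Real.exp (-(2 * (n : ℝ) / 3) * x ^ (3 / 2 : ℝ)) *
        x ^ (-(3 * (n : ℝ) / 4) - 1) := by
  obtain ⟨C, hC⟩ := norm_integral_exp_mul_gaussianWeight_sub_le n
    (by positivity : (0 : ℝ) ≤ 4 / n)
  refine IsBigO.of_bound (C / (2 * Real.pi) ^ n) ?_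
  filter_upwards [eventually_gt_atTop 0] with x hx
  set q := x ^ (1 / 4 : ℝ) with hqdef
  have hq : 0 < q := Real.rpow_pos_of_pos hx _
  have hq4 : q ^ 4 = x := by
    rw [hqdef, ← Real.rpow_natCast, ← Real.rpow_mul hx.le]; norm_num
  have hq6 : q ^ 6 = x ^ (3 / 2 : ℝ) := by
    rw [hqdef, ← Real.rpow_natCast, ← Real.rpow_mul hx.le]; norm_num
  have hε : (-(q⁻¹ ^ 3)) ^ 2 = x ^ (-(3 / 2) : ℝ) := by
    rw [Real.rpow_neg hx.le, ← hq6, neg_sq, inv_pow, inv_pow, ← pow_mul]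
  have hs := symmIntegral_saddle n (4 / n) hq
  rw [hq4, saddle_scaling hn hx, hq6] at hs
  have hC' := hC (-(q⁻¹ ^ 3))
  rw [hε] at hC'
  set H := ∫ u, Complex.exp (Complex.I * ((-(q⁻¹ ^ 3) * cubicSum n u : ℝ) : ℂ)) *
    (gaussianWeight n (4 / n) u : ℂ)
  set E := Real.exp (-(2 * (n : ℝ) / 3) * x ^ (3 / 2 : ℝ))
  set A := x ^ (-(3 * (n : ℝ) / 4) + 1 / 2) with hA
  have hA0 : 0 < A := Real.rpow_pos_of_pos hx _
  have hE0 : 0 < E := Real.exp_pos _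
  have hsub : kontsevichK n n x - ((kontsevichLeading n x : ℝ) : ℂ) =
      ((A * E / (2 * Real.pi) ^ n : ℝ) : ℂ) *
        (H - ((∫ u, gaussianWeight n (4 / n) u : ℝ) : ℂ)) := by
    have hL : kontsevichLeading n x =
        (∫ u, gaussianWeight n (4 / n) u) / (2 * Real.pi) ^ n * E * A := rfl
    rw [kontsevichK_eq hn hev x (pow_pos hq 2), hs, hL]
    simp only [Complex.ofReal_mul, Complex.ofReal_div, Complex.ofReal_pow, Complex.ofReal_ofNat]
    ring
  rw [hsub, norm_mul, Complex.norm_real, Real.norm_of_nonneg (by positivity)]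
  have hx1 : x ^ (-(3 * (n : ℝ) / 4) - 1) = A * x ^ (-(3 / 2) : ℝ) := by
    rw [hA, ← Real.rpow_add hx]; congr 1; ring
  rw [hx1, Real.norm_of_nonneg (by positivity)]
  calc _ ≤ A * E / (2 * Real.pi) ^ n * (C * x ^ (-(3 / 2) : ℝ)) := by gcongr
    _ = _ := by ring

theorem mainTheorem9 (β : ℕ) (hβ : 0 < β) (hβ_even : Even β) :
    -- the integral defining `K_{β,β}(x)` makes sense for every real `x`
    (∀ x c : ℝ, 0 < c →
      IntegrableOn (kontsevichIntegrand β (β : ℝ) c x) (orderedDomain β)) ∧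
    (∀ x : ℝ, Tendsto (fun c : ℝ => kontsevichLine β (β : ℝ) c x) (𝓝[>] (0 : ℝ))
      (𝓝 (kontsevichK β (β : ℝ) x))) ∧
    -- the expansion, with an error that is small relative to the leading term
    ((fun x : ℝ => kontsevichK β (β : ℝ) x - ((kontsevichLeading β x : ℝ) : ℂ)) =O[atTop]
      (fun x : ℝ => Real.exp (-(2 * (β : ℝ) / 3) * x ^ (3 / 2 : ℝ)) *
        x ^ (-(3 * (β : ℝ) / 4) - 1))) ∧
    -- the expansion with the error term without its exponential factor
    ((fun x : ℝ => kontsevichK β (β : ℝ) x - ((kontsevichLeading β x : ℝ) : ℂ)) =O[atTop]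
      (fun x : ℝ => x ^ (-(3 * (β : ℝ) / 4) - 1))) := by
  have hO := kontsevichK_sub_leading_isBigO hβ hβ_even
  refine ⟨fun x c hc => integrableOn_kontsevichIntegrand hβ hβ_even x hc, fun x => ?_, hO,
    hO.trans (IsBigO.of_bound 1 ?_)⟩
  · rw [kontsevichK_eq hβ hβ_even x one_pos]
    exact tendsto_kontsevichLine hβ hβ_even x one_pos
  · filter_upwards [eventually_gt_atTop 0] with x hx
    rw [norm_mul, one_mul, Real.norm_of_nonneg (Real.exp_pos _).le]
    refine mul_le_of_le_one_left (norm_nonneg _) (Real.exp_le_one_iff.2 ?_)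
    rw [neg_mul]
    exact neg_nonpos.2 (by positivity)
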